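/- A \emph{pebble distribution} on a finite simple graph $G$ is a function $P\colon V(G)\to\mathbb{Z}_{\ge 0}$; its \emph{size} is $|P|=\sum_{v\in V(G)}P(v)$. A \emph{pebbling move} removes two pebbles from a vertex carrying at least two pebbles and adds one pebble to a neighbour of that vertex. A distribution $P$ is \emph{solvable} if, for every vertex $v$, some finite (possibly empty) sequence of pebbling moves starting from $P$ leads to a distribution with at least one pebble on $v$. The \emph{optimal pebbling number} $\pi_{\mathrm{opt}}(G)$ is the minimum size of a solvable distribution on $G$. Let $C_k$ denote the cycle on $k$ vertices and let $T_{m,n}=C_m\,\square\,C_n$ be the torus grid, i.e. the Cartesian product of two cycles. \textbf{Theorem.} For all integers $m,n\ge 5$, $$\pi_{\mathrm{opt}}(T_{m,n})\ \ge\ \frac{2}{13}\,nm .$$ Equivalently, every solvable pebble distribution on $T_{m,n}$ has size at least $\frac{2}{13}nm$. -/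

import Mathlib

namespace Pebbling

variable {V : Type*}

/-- A pebble distribution on a graph with vertex set `V`. -/
abbrev Distribution (V : Type*) := V → ℕ

/-- The size of a distribution: the total number of pebbles. -/
def size [Fintype V] (P : Distribution V) : ℕ := ∑ v, P v

/-- `Move G P Q`: the distribution `Q` arises from `P` by one pebbling move, which removes two
pebbles from some vertex `u` (so that `u` has at least two pebbles under `P`) and adds one pebble
to a neighbour `v` of `u`. -/
def Move (G : SimpleGraph V) (P Q : Distribution V) : Prop :=
  ∃ u v, G.Adj u v ∧ P u = Q u + 2 ∧ Q v = P v + 1 ∧ ∀ w, w ≠ u → w ≠ v → Q w = P w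

/-- `MovesTo G P Q`: the distribution `Q` arises from `P` by an executable (finite, possibly empty)
sequence of pebbling moves. -/
def MovesTo (G : SimpleGraph V) : Distribution V → Distribution V → Prop :=
  Relation.ReflTransGen (Move G)

/-- The vertex `v` is `k`-reachable under `P`. -/
def KReachable (G : SimpleGraph V) (P : Distribution V) (k : ℕ) (v : V) : Prop :=
  ∃ Q, MovesTo G P Q ∧ k ≤ Q v

/-- A distribution is solvable if every vertex is (`1`-)reachable under it. -/
def Solvable (G : SimpleGraph V) (P : Distribution V) : Prop :=
  ∀ v, KReachable G P 1 v

/-- The optimal pebbling number: the minimal size of a solvable distribution. -/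
noncomputable def optimalPebblingNumber [Fintype V] (G : SimpleGraph V) : ℕ :=
  sInf {k | ∃ P : Distribution V, Solvable G P ∧ size P = k}

/-- The infimum in the definition of the optimal pebbling number is an attained minimum. -/
theorem isLeast_optimalPebblingNumber [Fintype V] (G : SimpleGraph V) :
    IsLeast {k | ∃ P : Distribution V, Solvable G P ∧ size P = k} (optimalPebblingNumber G) :=
  ⟨Nat.sInf_mem ⟨size (fun _ : V => 1), fun _ => 1,
    fun _ => ⟨_, Relation.ReflTransGen.refl, le_rfl⟩, rfl⟩, fun _ hk => Nat.sInf_le hk⟩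

/-- The torus grid `T_{m,n}`, the Cartesian product of the cycles `C_m` and `C_n`. -/
def torusGrid (m n : ℕ) : SimpleGraph (Fin m × Fin n) :=
  (SimpleGraph.cycleGraph m).boxProd (SimpleGraph.cycleGraph n)

end Pebbling

/-! Let `H` be the set of 2-reachable vertices, `N` the other vertices with a neighbour in `H`, and
`S` the rest; solvability forces a pebble on each vertex of `S`. Pebbling moves start in `H`, so
with `K` the subgraph induced on `H` the sum of `P x * decay K x v` never increases, and is at least
2 for each `v ∈ H` (`sum_weight_le_of_movesTo`).

Add these inequalities with factor `4 - d v / 2` for `v ∈ H`, where `d` is the degree in `K`, and `3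
/ 2` at a chosen neighbour `η v ∈ H` for each `v ∈ N`. Since `N` has at most `∑ (4 - d)` vertices,
the constants total at least `4 (|H| + |N|)`. A single pebble contributes at most 26
(`contribution_le`): its weights extended over `H ∪ N` total at most 9, and `three_mul_sum_decay_le`
bounds the degree-weighted sum from below. Hence `|H| + |N|` is at most 13/2 times the number of
pebbles on `H`. -/

namespace Pebbling

/-! ### Exponentially decaying weights in a subgraph. -/

section Decay

variable {V : Type*}

open Classical in
/-- The weight `2 ^ (-d)` of a pair of vertices at distance `d`, which is `0` if the vertices are
in different components. -/
noncomputable def decay (K : SimpleGraph V) (u v : V) : ℝ :=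
  if K.Reachable u v then (1 / 2 : ℝ) ^ K.dist u v else 0

theorem decay_nonneg (K : SimpleGraph V) (u v : V) : 0 ≤ decay K u v := by
  unfold decay
  split_ifs <;> positivity

theorem decay_self (K : SimpleGraph V) (u : V) : decay K u u = 1 := by
  simp [decay]

theorem decay_comm (K : SimpleGraph V) (u v : V) : decay K u v = decay K v u := by
  unfold decay
  rw [SimpleGraph.dist_comm]
  classical exact if_congr SimpleGraph.reachable_comm rfl rfl

theorem decay_le_two_mul_of_adj {K : SimpleGraph V} {x y : V} (h : K.Adj x y) (v : V) :
    decay K x v ≤ 2 * decay K y v := by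
  by_cases hx : K.Reachable x v
  · have hy : K.Reachable y v := h.symm.reachable.trans hx
    obtain ⟨p, hp⟩ := hx.exists_walk_length_eq_dist
    have hd : K.dist y v ≤ K.dist x v + 1 := by
      simpa [hp] using SimpleGraph.dist_le (SimpleGraph.Walk.cons h.symm p)
    have := pow_le_pow_of_le_one (by norm_num : (0 : ℝ) ≤ 1 / 2) (by norm_num) hd
    simp only [decay, hx, hy, if_true]
    rw [pow_succ] at this
    linarith
  · have := decay_nonneg K y v
    rw [decay, if_neg hx]
    linarith

/-- Take the first step of a shortest path from `v` to `u`. -/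
theorem exists_adj_two_mul_decay_le {K : SimpleGraph V} {u v : V} (hne : v ≠ u)
    (hr : K.Reachable v u) : ∃ w, K.Adj v w ∧ 2 * decay K v u ≤ decay K w u := by
  obtain ⟨p, hp⟩ := hr.exists_walk_length_eq_dist
  cases p with
  | nil => exact absurd rfl hne
  | @cons _ w _ h q =>
    refine ⟨w, h, ?_⟩
    have hd : K.dist w u + 1 ≤ K.dist v u := by
      rw [← hp, SimpleGraph.Walk.length_cons]
      exact Nat.succ_le_succ (SimpleGraph.dist_le q)
    have := pow_le_pow_of_le_one (by norm_num : (0 : ℝ) ≤ 1 / 2) (by norm_num) hd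
    simp only [decay, hr, q.reachable, if_true]
    rw [pow_succ] at this
    linarith

/-- A function that at most halves along edges dominates the decay of a subgraph. -/
theorem decay_le_of_halving {G K : SimpleGraph V} (hKG : K ≤ G) {u : V} {t : V → ℝ}
    (ht0 : ∀ v, 0 ≤ t v) (htu : t u = 1) (ht : ∀ x y, G.Adj x y → t x ≤ 2 * t y) (v : V) :
    decay K v u ≤ t v := by
  have walk : ∀ {a b : V} (p : K.Walk a b), t b * (1 / 2 : ℝ) ^ p.length ≤ t a := by
    intro a b p
    induction p with
    | nil => simp
    | @cons a c b h q ih =>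
      have := ht c a (hKG h).symm
      rw [SimpleGraph.Walk.length_cons, pow_succ]
      linarith
  unfold decay
  split_ifs with hr
  · obtain ⟨p, hp⟩ := hr.exists_walk_length_eq_dist
    simpa [hp, htu] using walk p
  · exact ht0 v

/-- A vertex `v` other than `u` has a neighbour of twice its decay, so the
degree-weighted sum of the decays is large. -/
theorem three_mul_sum_decay_le [DecidableEq V] (K : SimpleGraph V) [DecidableRel K.Adj]
    (H : Finset V) (hK : ∀ x y, K.Adj x y → x ∈ H ∧ y ∈ H) (u : V) :
    3 * ∑ v ∈ H.erase u, decay K v u ≤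
      ∑ v ∈ H, ((H.filter (K.Adj v)).card : ℝ) * decay K v u := by
  set g : V → ℝ := fun v => decay K v u with hg
  have hg0 : ∀ v, 0 ≤ g v := fun v => decay_nonneg K v u
  -- Orient edges towards larger decay. Each edge is used at most once and pays `g v + g w`, at
  -- least `3 * g v` on the edge towards `u`.
  let up : V → V → ℝ := fun v w => if K.Adj v w ∧ g v < g w then 1 else 0
  have hdeg : ∑ v ∈ H, ((H.filter (K.Adj v)).card : ℝ) * g v =
      ∑ v ∈ H, ∑ w ∈ H, if K.Adj v w then g v else 0 := by
    refine Finset.sum_congr rfl fun v _ => ?_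
    rw [← Finset.sum_filter, Finset.sum_const, nsmul_eq_mul]
  have hswap : ∑ v ∈ H, ∑ w ∈ H, up v w * (g v + g w) ≤
      ∑ v ∈ H, ∑ w ∈ H, if K.Adj v w then g v else 0 := by
    have h1 : ∑ v ∈ H, ∑ w ∈ H, up v w * (g v + g w) =
        ∑ v ∈ H, ∑ w ∈ H, (up v w + up w v) * g v := by
      simp only [mul_add, add_mul, Finset.sum_add_distrib]
      congr 1
      exact Finset.sum_comm
    rw [h1]
    refine Finset.sum_le_sum fun v _ => Finset.sum_le_sum fun w _ => ?_
    by_cases hvw : K.Adj v w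
    · simp only [up, hvw, hvw.symm, true_and, if_true]
      have := hg0 v
      split_ifs with h1 h2 <;> linarith
    · have hwv : ¬ K.Adj w v := fun h => hvw h.symm
      simp [up, hvw, hwv]
  have hlow : ∑ v ∈ H.erase u, 3 * g v ≤ ∑ v ∈ H, ∑ w ∈ H, up v w * (g v + g w) := by
    have hup : ∀ v w, 0 ≤ up v w * (g v + g w) := fun v w =>
      mul_nonneg (by simp only [up]; split_ifs <;> norm_num) (add_nonneg (hg0 v) (hg0 w))
    refine le_trans (Finset.sum_le_sum fun v hv => ?_) (Finset.sum_le_sum_of_subset_of_nonneg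
      (H.erase_subset u) fun v _ _ => Finset.sum_nonneg fun w _ => hup v w)
    by_cases hr : K.Reachable v u
    · obtain ⟨w, hvw, hw⟩ := exists_adj_two_mul_decay_le (Finset.ne_of_mem_erase hv) hr
      have hpos : 0 < g v := by simp only [hg, decay, hr, if_true]; positivity
      have hlt : g v < g w := by simp only [hg] at hpos ⊢; linarith
      refine le_trans ?_ (Finset.single_le_sum (fun w _ => hup v w) (hK v w hvw).2)
      have hup1 : up v w = 1 := if_pos ⟨hvw, hlt⟩
      rw [hup1]
      simp only [hg]
      linarith
    · have : g v = 0 := by simp only [hg, decay, hr, if_false]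
      rw [this, mul_zero]
      exact Finset.sum_nonneg fun w _ => by simpa [this] using hup v w
  rw [Finset.mul_sum]
  exact hlow.trans (hswap.trans hdeg.ge)

end Decay

/-! ### Invariants of pebbling moves. -/

section Moves

variable {V : Type*}

/-- A weight that at most doubles along each move from a `2`-reachable vertex has a total which
does not increase under pebbling. -/
theorem sum_weight_le_of_movesTo [Fintype V] {G : SimpleGraph V} {P Q : Distribution V}
    {ω : V → ℝ} (hω : ∀ u w, KReachable G P 2 u → G.Adj u w → ω w ≤ 2 * ω u)
    (h : MovesTo G P Q) : ∑ x, (Q x : ℝ) * ω x ≤ ∑ x, (P x : ℝ) * ω x := by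
  classical
  induction h with
  | refl => exact le_rfl
  | @tail Q Q' hPQ hQ ih =>
    refine le_trans ?_ ih
    obtain ⟨u, v, huv, hu, hv, hrest⟩ := hQ
    have hstep : ∀ x, (Q' x : ℝ) * ω x = (Q x : ℝ) * ω x +
        ((if x = v then ω v else 0) - (if x = u then 2 * ω u else 0)) := by
      intro x
      by_cases hxu : x = u
      · subst hxu
        simp only [huv.ne, if_true, if_false, hu]
        push_cast
        ring
      · by_cases hxv : x = v
        · subst hxv
          simp only [hxu, if_true, if_false, hv]
          push_cast
          ring
        · simp [hxu, hxv, hrest x hxu hxv]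
    have hle := hω u v ⟨Q, hPQ, by omega⟩ huv
    simp only [hstep, Finset.sum_add_distrib, Finset.sum_sub_distrib, Finset.sum_ite_eq',
      Finset.mem_univ, if_true]
    linarith

/-- A vertex without pebbles that becomes occupied has a `2`-reachable neighbour. -/
theorem exists_adj_kReachable_two {G : SimpleGraph V} {P Q : Distribution V} (h : MovesTo G P Q)
    {v : V} (hP : P v = 0) (hQ : 1 ≤ Q v) : ∃ u, G.Adj v u ∧ KReachable G P 2 u := by
  induction h with
  | refl => omega
  | @tail Q Q' hPQ hstep ih =>
    by_cases hv : 1 ≤ Q v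
    · exact ih hv
    · obtain ⟨u, w, huw, hu, hw, hrest⟩ := hstep
      have hvu : v ≠ u := by rintro rfl; omega
      have hvw : v = w := by
        by_contra hvw
        have := hrest v hvu hvw
        omega
      subst hvw
      exact ⟨u, huw.symm, Q, hPQ, by omega⟩

end Moves

/-! ### The weighted double count in graphs of maximum degree at most 4. -/

section LowerBound

variable {V : Type*}

theorem card_filter_add_card_filter_le [Fintype V] [DecidableEq V] {G K : SimpleGraph V}
    [DecidableRel G.Adj] [DecidableRel K.Adj] {k : ℕ} (hdeg : ∀ v, G.degree v ≤ k)
    (H N : Finset V) (hHN : Disjoint H N) (hK : ∀ x y, K.Adj x y ↔ G.Adj x y ∧ x ∈ H ∧ y ∈ H)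
    (v : V) : (H.filter (K.Adj v)).card + (N.filter (G.Adj v)).card ≤ k := by
  rw [← Finset.card_union_of_disjoint (Finset.disjoint_filter_filter hHN)]
  refine (Finset.card_le_card fun w hw => ?_).trans (hdeg v)
  simp only [Finset.mem_union, Finset.mem_filter, hK] at hw
  rw [SimpleGraph.mem_neighborFinset]
  tauto

/-- Summing over vertices of `N` with a chosen neighbour in `H` counts each vertex of `H` at most
as often as it has neighbours outside `H`. -/
theorem sum_comp_le_sum_out_degree [Fintype V] [DecidableEq V] {G K : SimpleGraph V}
    [DecidableRel G.Adj] [DecidableRel K.Adj] {k : ℕ} (hdeg : ∀ v, G.degree v ≤ k)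
    (H N : Finset V) (hHN : Disjoint H N) (hK : ∀ x y, K.Adj x y ↔ G.Adj x y ∧ x ∈ H ∧ y ∈ H)
    {η : V → V} (hη : ∀ v ∈ N, G.Adj v (η v) ∧ η v ∈ H) {g : V → ℝ} (hg0 : ∀ v, 0 ≤ g v) :
    ∑ v ∈ N, g (η v) ≤ ∑ h ∈ H, ((k : ℝ) - ((H.filter (K.Adj h)).card : ℝ)) * g h := by
  calc ∑ v ∈ N, g (η v) ≤ ∑ v ∈ N, ∑ h ∈ H, if G.Adj h v then g h else 0 := by
        refine Finset.sum_le_sum fun v hv => ?_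
        have := Finset.single_le_sum (f := fun h => if G.Adj h v then g h else 0)
          (fun h _ => by split_ifs <;> simp [hg0]) (hη v hv).2
        simpa [(hη v hv).1.symm] using this
    _ = ∑ h ∈ H, ((N.filter (G.Adj h)).card : ℝ) * g h := by
        rw [Finset.sum_comm]
        refine Finset.sum_congr rfl fun h _ => ?_
        rw [← Finset.sum_filter, Finset.sum_const, nsmul_eq_mul]
    _ ≤ _ := by
        refine Finset.sum_le_sum fun h _ => mul_le_mul_of_nonneg_right ?_ (hg0 h)
        have : ((H.filter (K.Adj h)).card : ℝ) + (N.filter (G.Adj h)).card ≤ k := by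
          exact_mod_cast card_filter_add_card_filter_le hdeg H N hHN hK h
        linarith

/-- The contribution of one vertex `u` of `H` to the weight count: `N` is a set of vertices
outside `H`, each with a chosen neighbour `η v` in `H`. -/
theorem contribution_le [Fintype V] [DecidableEq V] {G K : SimpleGraph V} [DecidableRel G.Adj]
    [DecidableRel K.Adj] (hdeg : ∀ v, G.degree v ≤ 4) (H N : Finset V) (hHN : Disjoint H N)
    (hK : ∀ x y, K.Adj x y ↔ G.Adj x y ∧ x ∈ H ∧ y ∈ H) {η : V → V}
    (hη : ∀ v ∈ N, G.Adj v (η v) ∧ η v ∈ H) {u : V} (hu : u ∈ H) {t : V → ℝ}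
    (ht0 : ∀ v, 0 ≤ t v) (htu : t u = 1) (ht : ∀ x y, G.Adj x y → t x ≤ 2 * t y)
    (hsum : ∑ v, t v ≤ 9) :
    ∑ v ∈ H, (4 - ((H.filter (K.Adj v)).card : ℝ) / 2) * decay K v u +
      3 * ∑ v ∈ N, decay K (η v) u / 2 ≤ 26 := by
  set g : V → ℝ := fun v => decay K v u with hg
  have hg0 : ∀ v, 0 ≤ g v := fun v => decay_nonneg K v u
  have hgt : ∀ v, g v ≤ t v :=
    decay_le_of_halving (fun x y h => ((hK x y).1 h).1) ht0 htu ht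
  have hA := three_mul_sum_decay_le K H (fun x y h => ((hK x y).1 h).2) u
  have hsplit : ∑ v ∈ H, g v = 1 + ∑ v ∈ H.erase u, g v := by
    rw [← Finset.add_sum_erase H g hu]
    simp only [hg, decay_self]
  -- Distances in `K` only exceed those in `G`, and leaving `H` to `N` costs at most one halving, so
  -- `t` dominates both sums.
  have hAB : ∑ v ∈ H, g v + ∑ v ∈ N, g (η v) / 2 ≤ 9 := by
    refine le_trans (add_le_add (Finset.sum_le_sum fun v _ => hgt v)
      (Finset.sum_le_sum (g := t) fun v hv => ?_)) ?_
    · have h1 := hgt (η v)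
      have h2 := ht _ _ (hη v hv).1.symm
      linarith
    · rw [← Finset.sum_union hHN]
      exact (Finset.sum_le_sum_of_subset_of_nonneg (Finset.subset_univ _)
        fun v _ _ => ht0 v).trans hsum
  have hB := sum_comp_le_sum_out_degree hdeg H N hHN hK hη hg0
  have e1 : ∑ v ∈ H, (4 - ((H.filter (K.Adj v)).card : ℝ) / 2) * g v =
      4 * ∑ v ∈ H, g v - (∑ v ∈ H, ((H.filter (K.Adj v)).card : ℝ) * g v) / 2 := by
    rw [Finset.mul_sum, Finset.sum_div, ← Finset.sum_sub_distrib]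
    exact Finset.sum_congr rfl fun v _ => by ring
  have e2 : ∑ v ∈ H, (4 - ((H.filter (K.Adj v)).card : ℝ)) * g v =
      4 * ∑ v ∈ H, g v - ∑ v ∈ H, ((H.filter (K.Adj v)).card : ℝ) * g v := by
    rw [Finset.mul_sum, ← Finset.sum_sub_distrib]
    exact Finset.sum_congr rfl fun v _ => by ring
  change ∑ v ∈ H, (4 - ((H.filter (K.Adj v)).card : ℝ) / 2) * g v +
      3 * ∑ v ∈ N, g (η v) / 2 ≤ 26
  change 3 * ∑ v ∈ H.erase u, g v ≤ ∑ v ∈ H, ((H.filter (K.Adj v)).card : ℝ) * g v at hA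
  rw [← Finset.sum_div] at hAB ⊢
  rw [e1]
  rw [Nat.cast_ofNat, e2] at hB
  -- The combination is 8/3 of `hAB`, 2/3 of `hA` and 1/6 of `hB`; the constant is 24 + 2.
  linarith

/-- A solvable distribution on a graph of maximum degree at most `4` in which the weights of the
vertices around any given one sum to at most `9` has at least `2 / 13` pebbles per vertex. -/
theorem two_mul_card_le_of_solvable [Fintype V] {G : SimpleGraph V} [DecidableRel G.Adj]
    (hdeg : ∀ v, G.degree v ≤ 4) {t : V → V → ℝ} (ht0 : ∀ u v, 0 ≤ t u v)
    (htu : ∀ u, t u u = 1) (ht : ∀ u x y, G.Adj x y → t u x ≤ 2 * t u y)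
    (hsum : ∀ u, ∑ v, t u v ≤ 9) {P : Distribution V} (hP : Solvable G P) :
    2 * (Fintype.card V : ℝ) ≤ 13 * (size P : ℝ) := by
  classical
  let H : Finset V := Finset.univ.filter fun v => KReachable G P 2 v
  let N : Finset V := Finset.univ.filter fun v => v ∉ H ∧ ∃ h ∈ H, G.Adj v h
  let S : Finset V := Finset.univ.filter fun v => v ∉ H ∧ ¬ ∃ h ∈ H, G.Adj v h
  let K : SimpleGraph V :=
    { Adj := fun x y => G.Adj x y ∧ x ∈ H ∧ y ∈ H
      symm := ⟨fun x y h => ⟨h.1.symm, h.2.2, h.2.1⟩⟩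
      loopless := ⟨fun x h => G.loopless.irrefl x h.1⟩ }
  have hK : ∀ x y, K.Adj x y ↔ G.Adj x y ∧ x ∈ H ∧ y ∈ H := fun x y => Iff.rfl
  have hex : ∀ v, ∃ h, v ∈ N → G.Adj v h ∧ h ∈ H := by
    intro v
    by_cases hv : v ∈ N
    · obtain ⟨h, hh, hvh⟩ := (Finset.mem_filter.1 hv).2.2
      exact ⟨h, fun _ => ⟨hvh, hh⟩⟩
    · exact ⟨v, fun h => absurd h hv⟩
  choose η hη using hex
  have hHN : Disjoint H N :=
    Finset.disjoint_left.2 fun v hv hvN => (Finset.mem_filter.1 hvN).2.1 hv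
  have hiso : ∀ x v, x ∉ H → v ∈ H → decay K x v = 0 := by
    intro x v hx hv
    have hr : ¬ K.Reachable x v := by
      rintro ⟨p⟩
      cases p with
      | nil => exact hx hv
      | cons h _ => exact hx h.2.1
    rw [decay, if_neg hr]
  -- The weight vanishes off `H`, so moves leaving `H` are harmless although `K` omits those edges.
  have hW : ∀ v ∈ H, 2 ≤ ∑ x ∈ H, (P x : ℝ) * decay K x v := by
    intro v hv
    obtain ⟨Q, hPQ, hQ⟩ := (Finset.mem_filter.1 hv).2
    have hmono := sum_weight_le_of_movesTo (ω := fun x => decay K x v) (fun a b ha hab => by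
      have ha' : a ∈ H := Finset.mem_filter.2 ⟨Finset.mem_univ _, ha⟩
      by_cases hb : b ∈ H
      · exact decay_le_two_mul_of_adj (K := K) ⟨hab.symm, hb, ha'⟩ v
      · rw [hiso b v hb hv]
        linarith [decay_nonneg K a v]) hPQ
    have hQv : (Q v : ℝ) * decay K v v ≤ ∑ x, (Q x : ℝ) * decay K x v :=
      Finset.single_le_sum (f := fun x => (Q x : ℝ) * decay K x v)
        (fun x _ => mul_nonneg (Nat.cast_nonneg _) (decay_nonneg K x v)) (Finset.mem_univ v)
    rw [decay_self, mul_one] at hQv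
    have h2 : (2 : ℝ) ≤ Q v := by exact_mod_cast hQ
    have hres : ∑ x ∈ H, (P x : ℝ) * decay K x v = ∑ x, (P x : ℝ) * decay K x v :=
      Finset.sum_subset (Finset.subset_univ H) fun x _ hx => by rw [hiso x v hx hv, mul_zero]
    linarith
  let d : V → ℝ := fun v => ((H.filter (K.Adj v)).card : ℝ)
  have hd4 : ∀ v, d v ≤ 4 := fun v => by
    have : ((H.filter (K.Adj v)).card : ℝ) + (N.filter (G.Adj v)).card ≤ 4 := by
      exact_mod_cast card_filter_add_card_filter_le hdeg H N hHN hK v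
    exact (le_add_of_nonneg_right (Nat.cast_nonneg _)).trans this
  have hNo : (N.card : ℝ) ≤ ∑ h ∈ H, (4 - d h) := by
    simpa using sum_comp_le_sum_out_degree hdeg H N hHN hK hη (g := 1) fun _ => zero_le_one
  have hmain : 4 * ((H.card : ℝ) + N.card) ≤ 26 * ∑ u ∈ H, (P u : ℝ) := by
    calc 4 * ((H.card : ℝ) + N.card) ≤ ∑ v ∈ H, (8 - d v) + 3 * N.card := by
          have : ∑ v ∈ H, (8 - d v) = ∑ v ∈ H, (4 - d v) + 4 * H.card := by
            simp only [Finset.sum_sub_distrib, Finset.sum_const, nsmul_eq_mul]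
            ring
          linarith
      _ = ∑ v ∈ H, (4 - d v / 2) * 2 + 3 * ∑ v ∈ N, (2 : ℝ) / 2 := by
          congr 1
          · exact Finset.sum_congr rfl fun v _ => by ring
          · simp
      _ ≤ ∑ v ∈ H, (4 - d v / 2) * ∑ u ∈ H, (P u : ℝ) * decay K u v +
            3 * ∑ v ∈ N, (∑ u ∈ H, (P u : ℝ) * decay K u (η v)) / 2 := by
          have h1 := Finset.sum_le_sum fun v (hv : v ∈ H) =>
            mul_le_mul_of_nonneg_left (hW v hv) (by linarith [hd4 v] : 0 ≤ 4 - d v / 2)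
          have h2 := Finset.sum_le_sum fun v (hv : v ∈ N) =>
            div_le_div_of_nonneg_right (hW _ (hη v hv).2) (zero_le_two : (0 : ℝ) ≤ 2)
          linarith
      _ = ∑ u ∈ H, (P u : ℝ) * (∑ v ∈ H, (4 - d v / 2) * decay K v u +
            3 * ∑ v ∈ N, decay K (η v) u / 2) := by
          simp only [mul_add, Finset.mul_sum, Finset.sum_div, Finset.sum_add_distrib]
          congr 1
          · rw [Finset.sum_comm]
            refine Finset.sum_congr rfl fun u _ => Finset.sum_congr rfl fun v _ => ?_
            rw [decay_comm K u v]
            ring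
          · rw [Finset.sum_comm]
            refine Finset.sum_congr rfl fun u _ => Finset.sum_congr rfl fun v _ => ?_
            rw [decay_comm K u (η v)]
            ring
      _ ≤ ∑ u ∈ H, (P u : ℝ) * 26 := by
          refine Finset.sum_le_sum fun u hu => mul_le_mul_of_nonneg_left ?_ (Nat.cast_nonneg _)
          exact contribution_le hdeg H N hHN hK hη hu (ht0 u) (htu u) (ht u) (hsum u)
      _ = _ := by rw [← Finset.sum_mul, mul_comm]
  have hHS : Disjoint H S :=
    Finset.disjoint_left.2 fun v hv hvS => (Finset.mem_filter.1 hvS).2.1 hv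
  have hS : (S.card : ℝ) ≤ ∑ v ∈ S, (P v : ℝ) := by
    have : ∑ v ∈ S, (1 : ℝ) ≤ ∑ v ∈ S, (P v : ℝ) := by
      refine Finset.sum_le_sum fun v hv => ?_
      rw [Nat.one_le_cast, Nat.one_le_iff_ne_zero]
      intro h0
      obtain ⟨Q, hPQ, hQ⟩ := hP v
      obtain ⟨u, hvu, hu⟩ := exists_adj_kReachable_two hPQ h0 hQ
      exact (Finset.mem_filter.1 hv).2.2
        ⟨u, Finset.mem_filter.2 ⟨Finset.mem_univ _, hu⟩, hvu⟩
    simpa using this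
  have hcard : (Fintype.card V : ℝ) ≤ H.card + N.card + S.card := by
    have hcover : (Finset.univ : Finset V) ⊆ H ∪ N ∪ S := by
      intro v _
      simp only [Finset.mem_union, N, S, Finset.mem_filter, Finset.mem_univ, true_and]
      by_cases hvH : v ∈ H
      · exact Or.inl (Or.inl hvH)
      · by_cases hvN : ∃ h ∈ H, G.Adj v h
        · exact Or.inl (Or.inr ⟨hvH, hvN⟩)
        · exact Or.inr ⟨hvH, hvN⟩
    have h1 := Finset.card_le_card hcover
    have h2 := Finset.card_union_le (H ∪ N) S
    have h3 := Finset.card_union_le H N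
    rw [Finset.card_univ] at h1
    exact_mod_cast (by omega : Fintype.card V ≤ H.card + N.card + S.card)
  have hsize : ∑ v ∈ H, (P v : ℝ) + ∑ v ∈ S, (P v : ℝ) ≤ size P := by
    rw [← Finset.sum_union hHS, size, Nat.cast_sum]
    exact Finset.sum_le_sum_of_subset_of_nonneg (Finset.subset_univ _)
      fun v _ _ => Nat.cast_nonneg _
  have hSpos : 0 ≤ ∑ v ∈ S, (P v : ℝ) := Finset.sum_nonneg fun v _ => Nat.cast_nonneg _
  -- Pebbles on `H` pay for 13/2 vertices each, those on `S` for one.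
  linarith

end LowerBound

/-! ### Distance weights on cycles and degrees in the torus. -/

section Torus

/-- The weight `2 ^ (-d)` of two vertices at distance `d` in the cycle on `n` vertices. -/
noncomputable def cycleWeight (n : ℕ) (a x : Fin n) : ℝ :=
  max ((1 / 2 : ℝ) ^ (x - a).val) ((1 / 2 : ℝ) ^ (n - (x - a).val))

theorem cycleWeight_nonneg (n : ℕ) (a x : Fin n) : 0 ≤ cycleWeight n a x :=
  le_max_of_le_left (by positivity)

theorem cycleWeight_self (n : ℕ) (a : Fin n) : cycleWeight n a a = 1 := by
  have : NeZero n := ⟨by have := a.isLt; omega⟩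
  rw [cycleWeight, sub_self, Fin.val_zero, pow_zero]
  exact max_eq_left (pow_le_one₀ (by norm_num) (by norm_num))

theorem cycleWeight_le_two_mul {n : ℕ} (a : Fin n) {x y : Fin n}
    (h : (SimpleGraph.cycleGraph n).Adj x y) : cycleWeight n a x ≤ 2 * cycleWeight n a y := by
  have half : ∀ i j : ℕ, j ≤ i + 1 → (1 / 2 : ℝ) ^ i ≤ 2 * (1 / 2 : ℝ) ^ j := by
    intro i j hij
    have := pow_le_pow_of_le_one (by norm_num : (0 : ℝ) ≤ 1 / 2) (by norm_num) hij
    rw [pow_succ] at this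
    linarith
  -- Offsets from `a` of adjacent vertices differ by one, or the edge wraps around at `a` and the
  -- two arcs swap roles.
  have hval : ((x - a).val + 1 = (y - a).val ∨ (y - a).val + 1 = (x - a).val) ∨
      ((x - a).val = 0 ∧ (y - a).val + 1 = n) ∨ ((y - a).val = 0 ∧ (x - a).val + 1 = n) := by
    rw [SimpleGraph.cycleGraph_adj'] at h
    have hx := x.isLt
    have hy := y.isLt
    have ha := a.isLt
    have hsub : ∀ p q : Fin n,
        (p - q).val = if q ≤ p then p.val - q.val else n + p.val - q.val := by
      intro p q
      split_ifs with hpq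
      · exact Fin.sub_val_of_le hpq
      · exact Fin.coe_sub_iff_lt.2 (not_le.1 hpq)
    simp only [hsub, Fin.le_def] at h ⊢
    split_ifs at h ⊢ <;> omega
  have hx := (x - a).isLt
  have hy := (y - a).isLt
  unfold cycleWeight
  generalize (x - a).val = i at *
  generalize (y - a).val = j at *
  rw [mul_max_of_nonneg _ _ (zero_le_two : (0 : ℝ) ≤ 2)]
  rcases hval with hij | hij | hij
  · exact max_le_max (half _ _ (by omega)) (half _ _ (by omega))
  · exact max_le (le_max_of_le_right (half _ _ (by omega)))
      (le_max_of_le_right (half _ _ (by omega)))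
  · exact max_le (le_max_of_le_left (half _ _ (by omega)))
      (le_max_of_le_left (half _ _ (by omega)))

/-- The vertex `a` gives 1, and each direction around the cycle a geometric series below 1. -/
theorem sum_cycleWeight_le (n : ℕ) (a : Fin n) : ∑ x, cycleWeight n a x ≤ 3 := by
  have : NeZero n := ⟨by have := a.isLt; omega⟩
  have geom : ∀ k : ℕ, ∑ i ∈ Finset.range k, (1 / 2 : ℝ) ^ (i + 1) ≤ 1 := by
    intro k
    have h : ∑ i ∈ Finset.range k, (1 / 2 : ℝ) ^ (i + 1) = 1 - (1 / 2 : ℝ) ^ k := by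
      induction k with
      | zero => simp
      | succ k ih => rw [Finset.sum_range_succ, ih, pow_succ]; ring
    rw [h]
    linarith [pow_nonneg (by norm_num : (0 : ℝ) ≤ 1 / 2) k]
  have hshift : ∑ x, cycleWeight n a x =
      ∑ i ∈ Finset.range n, max ((1 / 2 : ℝ) ^ i) ((1 / 2 : ℝ) ^ (n - i)) := by
    rw [← Fin.sum_univ_eq_sum_range fun i => max ((1 / 2 : ℝ) ^ i) ((1 / 2 : ℝ) ^ (n - i))]
    exact (Equiv.subRight a).sum_comp
      fun y : Fin n => max ((1 / 2 : ℝ) ^ y.val) ((1 / 2 : ℝ) ^ (n - y.val))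
  obtain ⟨k, rfl⟩ : ∃ k, n = k + 1 := Nat.exists_eq_succ_of_ne_zero (NeZero.ne n)
  rw [hshift, Finset.sum_range_succ']
  have h0 : max ((1 / 2 : ℝ) ^ 0) ((1 / 2 : ℝ) ^ (k + 1 - 0)) ≤ 1 :=
    max_le (by simp) (pow_le_one₀ (by norm_num) (by norm_num))
  have hrest : ∑ i ∈ Finset.range k,
      max ((1 / 2 : ℝ) ^ (i + 1)) ((1 / 2 : ℝ) ^ (k + 1 - (i + 1))) ≤
      ∑ i ∈ Finset.range k, (1 / 2 : ℝ) ^ (i + 1) +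
        ∑ i ∈ Finset.range k, (1 / 2 : ℝ) ^ (k - 1 - i + 1) := by
    rw [← Finset.sum_add_distrib]
    refine Finset.sum_le_sum fun i hi => ?_
    have hi' := Finset.mem_range.1 hi
    rw [show k - 1 - i + 1 = k + 1 - (i + 1) by omega]
    exact max_le_add_of_nonneg (by positivity) (by positivity)
  rw [Finset.sum_range_reflect (fun i => (1 / 2 : ℝ) ^ (i + 1)) k] at hrest
  linarith [geom k]

theorem torusGrid_degree_le {m n : ℕ} (v : Fin m × Fin n)
    [Fintype ((torusGrid m n).neighborSet v)] : (torusGrid m n).degree v ≤ 4 := by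
  classical
  have hcycle : ∀ {k : ℕ} (a : Fin k), (SimpleGraph.cycleGraph k).degree a ≤ 2 := by
    intro k a
    rcases k with _ | _ | k
    · exact a.elim0
    · have := SimpleGraph.degree_lt_card_verts (G := SimpleGraph.cycleGraph (0 + 1)) a
      rw [Fintype.card_fin] at this
      omega
    · rw [← SimpleGraph.card_neighborFinset_eq_degree,
        SimpleGraph.cycleGraph_neighborFinset]
      exact Finset.card_le_two
  have h := SimpleGraph.degree_boxProd (G := SimpleGraph.cycleGraph m)
    (H := SimpleGraph.cycleGraph n) v
  have h1 := hcycle v.1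
  have h2 := hcycle v.2
  have e : (torusGrid m n).degree v =
      ((SimpleGraph.cycleGraph m).boxProd (SimpleGraph.cycleGraph n)).degree v := by
    simp only [SimpleGraph.degree, SimpleGraph.neighborFinset, Set.toFinset_card]
    exact Fintype.card_congr (Equiv.refl _)
  omega

end Torus

end Pebbling

theorem mainTheorem2 (m n : ℕ) (hm : 5 ≤ m) (hn : 5 ≤ n) :
    (2 / 13 : ℝ) * ((n : ℝ) * (m : ℝ)) ≤
      (Pebbling.optimalPebblingNumber (Pebbling.torusGrid m n) : ℝ) := by
  classical
  obtain ⟨P, hP, hsize⟩ :=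
    (Pebbling.isLeast_optimalPebblingNumber (Pebbling.torusGrid m n)).1
  have h := Pebbling.two_mul_card_le_of_solvable (G := Pebbling.torusGrid m n)
    (fun v => Pebbling.torusGrid_degree_le v)
    -- Distances add in a Cartesian product, so weights multiply and total at most 3 * 3 = 9.
    (t := fun u v => Pebbling.cycleWeight m u.1 v.1 * Pebbling.cycleWeight n u.2 v.2)
    (fun u v => mul_nonneg (Pebbling.cycleWeight_nonneg m _ _) (Pebbling.cycleWeight_nonneg n _ _))
    (fun u => by simp only [Pebbling.cycleWeight_self, mul_one])
    (fun u x y hxy => by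
      have h1 := Pebbling.cycleWeight_nonneg m u.1 y.1
      have h2 := Pebbling.cycleWeight_nonneg n u.2 y.2
      rcases SimpleGraph.boxProd_adj.1 hxy with ⟨hadj, he⟩ | ⟨hadj, he⟩
      · rw [he, ← mul_assoc]
        exact mul_le_mul_of_nonneg_right (Pebbling.cycleWeight_le_two_mul u.1 hadj) h2
      · rw [he, mul_left_comm]
        exact mul_le_mul_of_nonneg_left (Pebbling.cycleWeight_le_two_mul u.2 hadj) h1)
    (fun u => by
      rw [Fintype.sum_prod_type, ← Finset.sum_mul_sum]
      have h1 := Pebbling.sum_cycleWeight_le m u.1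
      have h2 := Pebbling.sum_cycleWeight_le n u.2
      have h3 : 0 ≤ ∑ x, Pebbling.cycleWeight n u.2 x :=
        Finset.sum_nonneg fun x _ => Pebbling.cycleWeight_nonneg n _ _
      nlinarith) hP
  rw [Fintype.card_prod, Fintype.card_fin, Fintype.card_fin, hsize] at h
  push_cast at h
  linarith
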